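/- Consider $A\in\mathbb{R}^{m\times n}$ ($n\ge 1$) of full row rank, $b\in\mathbb{R}^m$, $c\in\mathbb{R}^n$, and the strictly feasible set $\mathcal{F}_p^0=\{x : Ax=b,\ x>0\}$. Write $X=\mathrm{diag}(x)$ (likewise $Z$, $W$), $M_X=AX^2A^\top$, $e=(1,\dots,1)^\top$, $P_B=I-B^\top(BB^\top)^{-1}B$, $\|a\|_x=\|X^{-1}a\|$, where $\|\cdot\|$ is the Euclidean or the spectral norm. For $\mu>0$ and $x\in\mathcal{F}_p^0$ let $$v=\tfrac1\mu Xc-e,\qquad \Delta x=-XP_{AX}v,\qquad \delta(x,\mu)=\|P_{AX}v\|$$ be the residual vector, the primal projected Newton direction and the centrality proximity. For $\nu>0$ the thresholded scaled distance is $$\|y-z\|_{x,\nu}=\Big(\sum_{x_j\ge\nu}\big(\tfrac{y_j-z_j}{x_j}\big)^2+\sum_{x_j<\nu}(y_j-z_j)^2\Big)^{1/2}.$$ *Algorithm (one direction of delayed scaling).* Input: $A,c,\mu,\nu,\varepsilon,x,z$ and a cached lower triangular $L$ with $LL^\top=M_Z$. Put $w_j=z_j$ if $x_j\ge\nu$ and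 $w_j=x_j$ if $x_j<\nu$, and $u=W(\tfrac1\mu Wc-WX^{-1}e)$. Apply the conjugate gradient method, started at $0$ and preconditioned with $M_Z=LL^\top$ (by forward and backward substitution), to $AW^2A^\top d=Au$, until the residual $r$ satisfies $25\,r^\top M_Z^{-1}r\le\varepsilon^2$; with the resulting $\hat d$ return $\Delta\hat x=W^2A^\top\hat d-u$. (With an exact solve this would be the surrogate direction $-WP_{AW}(\tfrac1\mu Wc-WX^{-1}e)$.) The cost is the number of additions, subtractions, multiplications, divisions and comparisons of real numbers, in exact arithmetic. **Theorem.** There is a universal constant $C>0$ such that the following holds for all such $m,n,A,b,c$. Let $\nu\in(0,1]$, $\mu>0$, $\varepsilon>0$, $\lambda_z\ge 0$, let $x,z\in\mathcal{F}_p^0$, let $M_Z\succeq\lambda_z I$, let a lower triangular $L$ with $LL^\top=M_Z$ be given, and suppose $$\|z-x\|_{x,\nu}\le\min\Big\{\frac{\sqrt{\lambda_z}}{2\|A\|},\ \frac14,\ \frac{\varepsilon}{6\,\delta(x,\mu)}\Big\}$$ (a bound with denominator $0$ is void). Then the algorithm terminates and returns $\Delta\hat x$ with $$\|\Delta x-\Delta\hat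 x\|_x\le\varepsilon ,$$ and its cost $T$ satisfies $T\le C\,n^2\log\big(2+\|v\|/\varepsilon\big)$. Moreover, if $\varepsilon\le\tfrac12$, then $T\le C\log(2+\|v\|)\cdot n^2\log(1/\varepsilon)$; that is, $T=O(n^2\log(1/\varepsilon))$ with a hidden constant that depends only on the size $\|v\|$ of the residual vector. -/

import Mathlib

open scoped Matrix Matrix.Norms.L2Operator

noncomputable section

namespace PrimalIPM

/-! ### Norms, feasible set, projected Newton direction -/

/-- The Euclidean norm of a coordinate vector. -/
def euclNorm {n : ℕ} (v : Fin n → ℝ) : ℝ :=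
  ‖(WithLp.toLp 2 v : EuclideanSpace ℝ (Fin n))‖

/-- The scaled norm `‖a‖_x = ‖X⁻¹ a‖` with `X = diag x`. -/
def scaledNorm {n : ℕ} (x a : Fin n → ℝ) : ℝ :=
  euclNorm (fun j => (x j)⁻¹ * a j)

/-- The `ν`-thresholded scaled distance `‖y - z‖_{x,ν}`: coordinates with `x_j ≥ ν` are scaled
by `1 / x_j`, coordinates with `x_j < ν` are not scaled. -/
def thresholdedDist {n : ℕ} (x : Fin n → ℝ) (ν : ℝ) (y z : Fin n → ℝ) : ℝ :=
  Real.sqrt ((∑ j with ν ≤ x j, ((x j)⁻¹ * (y j - z j)) ^ 2) + ∑ j with x j < ν, (y j - z j) ^ 2)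

/-- The strictly feasible primal points `{x : A x = b, x > 0}`. -/
def strictlyFeasible {m n : ℕ} (A : Matrix (Fin m) (Fin n) ℝ) (b : Fin m → ℝ) :
    Set (Fin n → ℝ) :=
  {x | A *ᵥ x = b ∧ ∀ j, 0 < x j}

/-- The primal normal matrix `M_X = A X² Aᵀ`. -/
def normalMatrix {m n : ℕ} (A : Matrix (Fin m) (Fin n) ℝ) (x : Fin n → ℝ) :
    Matrix (Fin m) (Fin m) ℝ :=
  A * Matrix.diagonal x ^ 2 * Aᵀ

/-- The projection `P_B = I - Bᵀ (B Bᵀ)⁻¹ B` onto the kernel of a matrix `B` of full row rank. -/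
def kerProj {m n : ℕ} (B : Matrix (Fin m) (Fin n) ℝ) : Matrix (Fin n) (Fin n) ℝ :=
  1 - Bᵀ * (B * Bᵀ)⁻¹ * B

/-- The vector `(1/μ) X c - e`. -/
def barrierResidual {n : ℕ} (c x : Fin n → ℝ) (μ : ℝ) : Fin n → ℝ :=
  (1 / μ) • (Matrix.diagonal x *ᵥ c) - 1

/-- The projected Newton direction `Δx = - X P_{AX} ((1/μ) X c - e)`. -/
def newtonDirection {m n : ℕ} (A : Matrix (Fin m) (Fin n) ℝ) (c x : Fin n → ℝ) (μ : ℝ) :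
    Fin n → ℝ :=
  -(Matrix.diagonal x *ᵥ (kerProj (A * Matrix.diagonal x) *ᵥ barrierResidual c x μ))

/-- The proximity to the central path, `δ(x, μ) = ‖P_{AX} ((1/μ) X c - e)‖`. -/
def proximity {m n : ℕ} (A : Matrix (Fin m) (Fin n) ℝ) (c x : Fin n → ℝ) (μ : ℝ) : ℝ :=
  euclNorm (kerProj (A * Matrix.diagonal x) *ᵥ barrierResidual c x μ)

/-- `L` is a (Cholesky) triangular factor of `M`: lower triangular with `L Lᵀ = M`. -/
def IsTriangularFactor {m : ℕ} (L M : Matrix (Fin m) (Fin m) ℝ) : Prop :=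
  (∀ i j, i < j → L i j = 0) ∧ L * Lᵀ = M

/-! ### Counting arithmetic operations

Exact real arithmetic. Each addition, subtraction, multiplication, division and comparison of two
real numbers costs one operation. Only the five primitives below create or inspect reals in the
algorithm. -/

/-- A result together with the number of arithmetic operations spent on it. -/
structure Counted (α : Type) where
  val : α
  ops : ℕ

namespace Counted

instance : Monad Counted where
  pure a := ⟨a, 0⟩
  bind t f := ⟨(f t.val).val, t.ops + (f t.val).ops⟩

def add (a b : ℝ) : Counted ℝ := ⟨a + b, 1⟩

def sub (a b : ℝ) : Counted ℝ := ⟨a - b, 1⟩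

def mul (a b : ℝ) : Counted ℝ := ⟨a * b, 1⟩

def div (a b : ℝ) : Counted ℝ := ⟨a / b, 1⟩

def le (a b : ℝ) : Counted Bool := ⟨decide (a ≤ b), 1⟩

/-- Compute the entries of a vector one after the other. -/
def vec {n : ℕ} (f : Fin n → Counted ℝ) : Counted (Fin n → ℝ) :=
  ⟨fun i => (f i).val, ∑ i, (f i).ops⟩

/-- Compute `n` terms and add them up. -/
def sum : {n : ℕ} → (Fin n → Counted ℝ) → Counted ℝ
  | 0, _ => pure 0
  | _ + 1, f => do
    let s ← sum (fun i => f i.castSucc)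
    let t ← f (Fin.last _)
    add s t

def dot {n : ℕ} (u v : Fin n → ℝ) : Counted ℝ :=
  sum fun i => mul (u i) (v i)

def mulVec {m n : ℕ} (A : Matrix (Fin m) (Fin n) ℝ) (v : Fin n → ℝ) : Counted (Fin m → ℝ) :=
  vec fun i => dot (A i) v

/-- `u + a v`. -/
def axpy {n : ℕ} (u : Fin n → ℝ) (a : ℝ) (v : Fin n → ℝ) : Counted (Fin n → ℝ) :=
  vec fun i => do
    let t ← mul a (v i)
    add (u i) t

/-- Substitution for `T y = r`, determining the unknowns in the given order. Unknowns that are not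
yet determined are stored as `0`. -/
def substitute {m : ℕ} (T : Matrix (Fin m) (Fin m) ℝ) (order : List (Fin m)) (r : Fin m → ℝ) :
    Counted (Fin m → ℝ) :=
  order.foldlM (init := fun _ => 0) fun y i => do
    let s ← dot (T i) y
    let t ← sub (r i) s
    let q ← div t (T i i)
    pure (Function.update y i q)

/-- Solve `L Lᵀ s = r` for a lower triangular `L`: forward, then backward substitution. -/
def factorSolve {m : ℕ} (L : Matrix (Fin m) (Fin m) ℝ) (r : Fin m → ℝ) : Counted (Fin m → ℝ) := do
  let y ← substitute L (List.finRange m) r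
  substitute Lᵀ (List.finRange m).reverse y

/-! ### Preconditioned conjugate gradients -/

/-- `A diag(q) Aᵀ p`, without forming the matrix. -/
def applyNormal {m n : ℕ} (A : Matrix (Fin m) (Fin n) ℝ) (q : Fin n → ℝ) (p : Fin m → ℝ) :
    Counted (Fin m → ℝ) := do
  let t ← mulVec Aᵀ p
  let t ← vec fun j => mul (q j) (t j)
  mulVec A t

/-- Iterate of the preconditioned conjugate gradient method: approximate solution `d`, residual
`r`, search direction `p`, and `ρ = ⟨r, (L Lᵀ)⁻¹ r⟩`. -/
structure PCGState (m : ℕ) where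
  d : Fin m → ℝ
  r : Fin m → ℝ
  p : Fin m → ℝ
  ρ : ℝ

/-- Start of the method at `d = 0` for the right-hand side `h`. -/
def pcgInit {m : ℕ} (L : Matrix (Fin m) (Fin m) ℝ) (h : Fin m → ℝ) : Counted (PCGState m) := do
  let s ← factorSolve L h
  let ρ ← dot h s
  pure ⟨fun _ => 0, h, s, ρ⟩

/-- One step for the matrix `A diag(q) Aᵀ` with preconditioner `L Lᵀ`. -/
def pcgStep {m n : ℕ} (A : Matrix (Fin m) (Fin n) ℝ) (q : Fin n → ℝ)
    (L : Matrix (Fin m) (Fin m) ℝ) (st : PCGState m) : Counted (PCGState m) := do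
  let g ← applyNormal A q st.p
  let pg ← dot st.p g
  let α ← div st.ρ pg
  let d ← axpy st.d α st.p
  let a ← sub 0 α
  let r ← axpy st.r a g
  let s ← factorSolve L r
  let ρ ← dot r s
  let β ← div ρ st.ρ
  let p ← axpy s β st.p
  pure ⟨d, r, p, ρ⟩

/-- Repeat until `⟨r, (L Lᵀ)⁻¹ r⟩ ≤ (ε / 5)²`; `none` if this takes more than `maxIter` steps. -/
def pcgLoop {m n : ℕ} (A : Matrix (Fin m) (Fin n) ℝ) (q : Fin n → ℝ)
    (L : Matrix (Fin m) (Fin m) ℝ) (ε : ℝ) : ℕ → PCGState m → Counted (Option (Fin m → ℝ))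
  | maxIter, st => do
    let lhs ← mul 25 st.ρ
    let rhs ← mul ε ε
    let small ← le lhs rhs
    if small then
      pure (some st.d)
    else
      match maxIter with
      | 0 => pure none
      | k + 1 => do
        let st' ← pcgStep A q L st
        pcgLoop A q L ε k st'

end Counted

open Counted

/-! ### The surrogate direction of the delayed-scaling method -/

/-- The delayed scaling point: `w_j = z_j` where `x_j ≥ ν`, and `w_j = x_j` where `x_j < ν`. -/
def delayedPoint {n : ℕ} (ν : ℝ) (x z : Fin n → ℝ) : Counted (Fin n → ℝ) :=
  vec fun j => do
    let large ← le ν (x j)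
    pure (if large then z j else x j)

/-- The direction computed in one iteration of the primal interior point method with delayed
scaling, from a cached triangular factor `L` of `M_Z`. With `u = W ((1/μ) W c - W X⁻¹ e)` it solves
`A W² Aᵀ d = A u` approximately, by conjugate gradients preconditioned with `M_Z = L Lᵀ`, and
returns `W² Aᵀ d - u`. For the exact solution `d` this is
`- W P_{AW} ((1/μ) W c - W X⁻¹ e)`. -/
def delayedDirection {m n : ℕ} (A : Matrix (Fin m) (Fin n) ℝ) (c : Fin n → ℝ) (μ ν ε : ℝ)
    (x z : Fin n → ℝ) (L : Matrix (Fin m) (Fin m) ℝ) (maxIter : ℕ) :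
    Counted (Option (Fin n → ℝ)) := do
  let w ← delayedPoint ν x z
  let q ← vec fun j => mul (w j) (w j)
  let u ← vec fun j => do
    let a ← div (c j) μ
    let b ← div 1 (x j)
    let g ← sub a b
    mul (q j) g
  let h ← mulVec A u
  let st ← pcgInit L h
  let res ← pcgLoop A q L ε maxIter st
  match res with
  | none => pure none
  | some d => do
    let t ← mulVec Aᵀ d
    let dx ← vec fun j => do
      let s ← mul (q j) (t j)
      sub s (u j)
    pure (some dx)

end PrimalIPM

end

open PrimalIPM

namespace PrimalIPM

/-! ### Values and operation counts of the building blocks -/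

namespace Counted

/-! Write D = W X⁻¹, p = P_{AX} v and k = ‖z - x‖_{x,ν}. The point w copies z where distance is
measured relatively and x where it is measured absolutely, so the single number k bounds both |w_j /
x_j - 1| and |w_j - z_j|. The relative bound controls accuracy, the absolute one conditioning.

Conditioning: since k ≤ √λ_z / (2‖A‖), the triangle inequality puts ‖W Aᵀ y‖ between 1/2 and 3/2 of
‖Z Aᵀ y‖, so M_Z / 4 ≤ M_W ≤ 9 M_Z / 4 (`quadForm_normalMatrix_bounds`). A conjugate gradient step
lowers the energy rᵀ M_W⁻¹ r at least as much as the steepest descent estimate guarantees, here to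
8/9 of its value (`IsPCGIterate.energy_pcgStep_le`). The argument is local to two successive
directions; neither global conjugacy nor Chebyshev polynomials are needed. The initial energy is at
most (5‖v‖/4)², so O(log(2 + ‖v‖/ε)) steps of O(n²) operations suffice.

Accuracy: if d has residual r, then `inv_mul_newtonDirection_sub` gives the scaled error exactly as
D (P_{AW} (D - D⁻¹) p + (AW)ᵀ M_W⁻¹ r). The first summand is at most (12/5) k δ ≤ 2ε/5; the second
has squared norm rᵀ M_W⁻¹ r ≤ 4 rᵀ M_Z⁻¹ r ≤ (2ε/5)². The factor D costs 5/4, for a total of ε. -/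

@[simp] theorem val_pure {α : Type} (a : α) : (pure a : Counted α).val = a := rfl

@[simp] theorem ops_pure {α : Type} (a : α) : (pure a : Counted α).ops = 0 := rfl

@[simp] theorem val_bind {α β : Type} (t : Counted α) (f : α → Counted β) :
    (t >>= f).val = (f t.val).val := rfl

@[simp] theorem ops_bind {α β : Type} (t : Counted α) (f : α → Counted β) :
    (t >>= f).ops = t.ops + (f t.val).ops := rfl

@[simp] theorem val_add (a b : ℝ) : (add a b).val = a + b := rfl

@[simp] theorem ops_add (a b : ℝ) : (add a b).ops = 1 := rfl

@[simp] theorem val_sub (a b : ℝ) : (sub a b).val = a - b := rfl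

@[simp] theorem ops_sub (a b : ℝ) : (sub a b).ops = 1 := rfl

@[simp] theorem val_mul (a b : ℝ) : (mul a b).val = a * b := rfl

@[simp] theorem ops_mul (a b : ℝ) : (mul a b).ops = 1 := rfl

@[simp] theorem val_div (a b : ℝ) : (div a b).val = a / b := rfl

@[simp] theorem ops_div (a b : ℝ) : (div a b).ops = 1 := rfl

@[simp] theorem val_le (a b : ℝ) : (le a b).val = decide (a ≤ b) := rfl

@[simp] theorem ops_le (a b : ℝ) : (le a b).ops = 1 := rfl

@[simp] theorem val_vec {n : ℕ} (f : Fin n → Counted ℝ) : (vec f).val = fun i => (f i).val := rfl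

@[simp] theorem ops_vec {n : ℕ} (f : Fin n → Counted ℝ) : (vec f).ops = ∑ i, (f i).ops := rfl

@[simp] theorem val_sum {n : ℕ} (f : Fin n → Counted ℝ) : (sum f).val = ∑ i, (f i).val := by
  induction n with
  | zero => simp [sum]
  | succ n ih => simp [sum, ih, Fin.sum_univ_castSucc]

@[simp] theorem ops_sum {n : ℕ} (f : Fin n → Counted ℝ) :
    (sum f).ops = ∑ i, (f i).ops + n := by
  induction n with
  | zero => simp [sum]
  | succ n ih => simp [sum, ih, Fin.sum_univ_castSucc]; ring

@[simp] theorem val_dot {n : ℕ} (u v : Fin n → ℝ) : (dot u v).val = u ⬝ᵥ v := by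
  simp [dot, dotProduct]

@[simp] theorem ops_dot {n : ℕ} (u v : Fin n → ℝ) : (dot u v).ops = 2 * n := by
  simp [dot]; ring

@[simp] theorem val_mulVec {m n : ℕ} (A : Matrix (Fin m) (Fin n) ℝ) (v : Fin n → ℝ) :
    (mulVec A v).val = A *ᵥ v := by
  ext i; simp [mulVec, Matrix.mulVec]

@[simp] theorem ops_mulVec {m n : ℕ} (A : Matrix (Fin m) (Fin n) ℝ) (v : Fin n → ℝ) :
    (mulVec A v).ops = m * (2 * n) := by
  simp [mulVec]

@[simp] theorem val_axpy {n : ℕ} (u : Fin n → ℝ) (a : ℝ) (v : Fin n → ℝ) :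
    (axpy u a v).val = u + a • v := by
  ext i; simp [axpy]

@[simp] theorem ops_axpy {n : ℕ} (u : Fin n → ℝ) (a : ℝ) (v : Fin n → ℝ) :
    (axpy u a v).ops = n * 2 := by
  simp [axpy]

theorem ops_foldlM {α β : Type} (f : β → α → Counted β) (k : ℕ) (hf : ∀ b a, (f b a).ops = k)
    (l : List α) (b : β) : (l.foldlM f b).ops = l.length * k := by
  induction l generalizing b with
  | nil => simp
  | cons a l ih => simp [ih, hf]; ring

theorem val_foldlM {α β : Type} (f : β → α → Counted β) (l : List α) (b : β) :
    (l.foldlM f b).val = l.foldl (fun b a => (f b a).val) b := by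
  induction l generalizing b with
  | nil => simp
  | cons a l ih => simp [ih]

@[simp] theorem ops_substitute {m : ℕ} (T : Matrix (Fin m) (Fin m) ℝ) (order : List (Fin m))
    (r : Fin m → ℝ) : (substitute T order r).ops = order.length * (2 * m + 2) := by
  unfold substitute
  apply ops_foldlM
  intro y i
  simp

@[simp] theorem ops_factorSolve {m : ℕ} (L : Matrix (Fin m) (Fin m) ℝ) (r : Fin m → ℝ) :
    (factorSolve L r).ops = 2 * (m * (2 * m + 2)) := by
  simp [factorSolve]; ring

/-- Folding the substitution step over `l` from `y` solves the rows of `l`, provided that each row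
of `l` involves only unknowns that precede it in the order, and leaves the unknowns outside `l`
untouched. -/
theorem foldl_substitution {m : ℕ} (T : Matrix (Fin m) (Fin m) ℝ) (r : Fin m → ℝ)
    (hT : ∀ i, T i i ≠ 0) (l : List (Fin m)) (hl : l.Pairwise fun i j => i ≠ j ∧ T i j = 0)
    (y : Fin m → ℝ) (hy : ∀ i ∈ l, y i = 0) :
    (∀ i ∉ l, l.foldl (fun y i => Function.update y i ((r i - T i ⬝ᵥ y) / T i i)) y i = y i) ∧
      ∀ i ∈ l, (T *ᵥ l.foldl (fun y i => Function.update y i ((r i - T i ⬝ᵥ y) / T i i)) y) i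
        = r i := by
  induction l generalizing y with
  | nil => simp
  | cons a l ih =>
    rw [List.pairwise_cons] at hl
    obtain ⟨ha, hl⟩ := hl
    have hal : a ∉ l := fun h => (ha a h).1 rfl
    set y' := Function.update y a ((r a - T a ⬝ᵥ y) / T a a) with hy'
    have hy'l : ∀ i ∈ l, y' i = 0 := fun i hi => by
      rw [hy', Function.update_of_ne (ha i hi).1.symm]
      exact hy i (List.mem_cons_of_mem _ hi)
    obtain ⟨h1, h2⟩ := ih hl y' hy'l
    simp only [List.foldl_cons]
    rw [← hy']
    set Y := l.foldl (fun y i => Function.update y i ((r i - T i ⬝ᵥ y) / T i i)) y' with hY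
    refine ⟨fun i hi => ?_, fun i hi => ?_⟩
    · rw [List.mem_cons, not_or] at hi
      rw [h1 i hi.2, hy', Function.update_of_ne hi.1]
    · rcases List.mem_cons.1 hi with rfl | hi
      -- Row `i` involves no unknown that is still to be determined, and `y i = 0` keeps the
      -- diagonal term out of the dot product; so the new entry solves the row and later updates
      -- cannot disturb it.
      · have hrow : ∀ j, T i j * Y j = T i j * y j + if j = i then r i - T i ⬝ᵥ y else 0 := by
          intro j
          by_cases hj : j ∈ l
          · rw [(ha j hj).2, if_neg (ha j hj).1.symm]; simp
          · rw [h1 j hj, hy']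
            by_cases hji : j = i
            · subst hji
              rw [Function.update_self, if_pos rfl, hy j List.mem_cons_self]
              have := hT j
              field_simp
              ring
            · rw [Function.update_of_ne hji, if_neg hji, add_zero]
        simp only [Matrix.mulVec, dotProduct, hrow, Finset.sum_add_distrib]
        simp
      · exact h2 i hi

theorem mulVec_substitute {m : ℕ} (T : Matrix (Fin m) (Fin m) ℝ) (r : Fin m → ℝ)
    (hT : ∀ i, T i i ≠ 0) (l : List (Fin m)) (hl : l.Pairwise fun i j => i ≠ j ∧ T i j = 0)
    (hmem : ∀ i, i ∈ l) : T *ᵥ (substitute T l r).val = r := by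
  ext i
  rw [substitute, val_foldlM]
  simpa using (foldl_substitution T r hT l hl (fun _ => 0) (fun _ _ => rfl)).2 i (hmem i)

theorem mulVec_factorSolve {m : ℕ} (L : Matrix (Fin m) (Fin m) ℝ)
    (hL : ∀ i j, i < j → L i j = 0) (hdiag : ∀ i, L i i ≠ 0) (r : Fin m → ℝ) :
    (L * Lᵀ) *ᵥ (factorSolve L r).val = r := by
  simp only [factorSolve, val_bind]
  rw [← Matrix.mulVec_mulVec, mulVec_substitute Lᵀ _ hdiag, mulVec_substitute L _ hdiag]
  · exact (List.pairwise_lt_finRange m).imp fun h => ⟨h.ne, hL _ _ h⟩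
  · simp
  · rw [List.pairwise_reverse]
    exact (List.pairwise_lt_finRange m).imp fun h => ⟨h.ne', hL _ _ h⟩
  · simp

@[simp] theorem val_applyNormal {m n : ℕ} (A : Matrix (Fin m) (Fin n) ℝ) (q : Fin n → ℝ)
    (p : Fin m → ℝ) :
    (applyNormal A q p).val = (A * Matrix.diagonal q * Aᵀ) *ᵥ p := by
  simp only [applyNormal, val_bind, val_mulVec, val_vec, val_mul, ← Matrix.mulVec_mulVec]
  congr 1
  ext j
  simp [Matrix.mulVec_diagonal]

@[simp] theorem ops_applyNormal {m n : ℕ} (A : Matrix (Fin m) (Fin n) ℝ) (q : Fin n → ℝ)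
    (p : Fin m → ℝ) : (applyNormal A q p).ops = 4 * m * n + n := by
  simp [applyNormal]; ring

theorem ops_pcgInit {m : ℕ} (L : Matrix (Fin m) (Fin m) ℝ) (h : Fin m → ℝ) :
    (pcgInit L h).ops = 4 * m ^ 2 + 6 * m := by
  simp [pcgInit]; ring

theorem ops_pcgStep {m n : ℕ} (A : Matrix (Fin m) (Fin n) ℝ) (q : Fin n → ℝ)
    (L : Matrix (Fin m) (Fin m) ℝ) (st : PCGState m) :
    (pcgStep A q L st).ops = 4 * m * n + n + 4 * m ^ 2 + 14 * m + 3 := by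
  simp [pcgStep]; ring

end Counted

/-! ### Quadratic forms of positive definite matrices -/

theorem dotProduct_mulVec_comm_of_isHermitian {m : ℕ} {M : Matrix (Fin m) (Fin m) ℝ}
    (hM : M.IsHermitian) (x y : Fin m → ℝ) : x ⬝ᵥ M *ᵥ y = y ⬝ᵥ M *ᵥ x := by
  have hT : Mᵀ = M := by simpa using hM.eq
  rw [Matrix.dotProduct_mulVec, ← Matrix.mulVec_transpose, hT, dotProduct_comm]

theorem mulVec_inv_mulVec_of_posDef {m : ℕ} {M : Matrix (Fin m) (Fin m) ℝ} (hM : M.PosDef)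
    (r : Fin m → ℝ) : M *ᵥ M⁻¹ *ᵥ r = r := by
  rw [Matrix.mulVec_mulVec, Matrix.mul_nonsing_inv _ ((Matrix.isUnit_iff_isUnit_det _).1 hM.isUnit),
    Matrix.one_mulVec]

theorem inv_mulVec_mulVec_of_posDef {m : ℕ} {M : Matrix (Fin m) (Fin m) ℝ} (hM : M.PosDef)
    (r : Fin m → ℝ) : M⁻¹ *ᵥ M *ᵥ r = r := by
  rw [Matrix.mulVec_mulVec, Matrix.nonsing_inv_mul _ ((Matrix.isUnit_iff_isUnit_det _).1 hM.isUnit),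
    Matrix.one_mulVec]

/-- Inversion reverses the Loewner order. -/
theorem inv_quadForm_le_of_quadForm_le {m : ℕ} {M N : Matrix (Fin m) (Fin m) ℝ} (hM : M.PosDef)
    (hN : N.PosDef) {a : ℝ} (ha : 0 < a)
    (h : ∀ y, y ⬝ᵥ M *ᵥ y ≤ a * (y ⬝ᵥ N *ᵥ y)) (r : Fin m → ℝ) :
    r ⬝ᵥ N⁻¹ *ᵥ r ≤ a * (r ⬝ᵥ M⁻¹ *ᵥ r) := by
  set y := N⁻¹ *ᵥ r
  set x := M⁻¹ *ᵥ r
  have hy : N *ᵥ y = r := mulVec_inv_mulVec_of_posDef hN r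
  have hx : M *ᵥ x = r := mulVec_inv_mulVec_of_posDef hM r
  -- Expanding the square gives yᵀMy - 2a yᵀr + a² xᵀr ≥ 0, and yᵀMy ≤ a yᵀr by the hypothesis at
  -- `y`.
  have h1 : 0 ≤ (y - a • x) ⬝ᵥ M *ᵥ (y - a • x) := by
    simpa using hM.posSemidef.dotProduct_mulVec_nonneg (y - a • x)
  have h2 := h y
  rw [hy] at h2
  simp only [Matrix.mulVec_sub, Matrix.mulVec_smul, dotProduct_sub, sub_dotProduct, hx,
    smul_dotProduct, dotProduct_smul, smul_eq_mul,
    dotProduct_mulVec_comm_of_isHermitian hM.isHermitian x y] at h1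
  rw [dotProduct_comm y r] at h1 h2
  rw [dotProduct_comm x r] at h1
  by_contra! hlt
  have := mul_lt_mul_of_pos_left hlt ha
  nlinarith

/-- The product of the diagonal entries is det L, a factor of det N > 0. Hence substitution never
divides by zero. -/
theorem IsTriangularFactor.diag_ne_zero {m : ℕ} {L N : Matrix (Fin m) (Fin m) ℝ}
    (hL : IsTriangularFactor L N) (hN : N.PosDef) (i : Fin m) : L i i ≠ 0 := by
  have hdet : (L * Lᵀ).det ≠ 0 := by rw [hL.2]; exact hN.det_pos.ne'
  rw [Matrix.det_mul, Matrix.det_of_isLowerTriangular L fun i j hij => hL.1 _ _ hij] at hdet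
  exact Finset.prod_ne_zero_iff.1 (left_ne_zero_of_mul hdet) i (Finset.mem_univ i)

theorem Counted.val_factorSolve {m : ℕ} {L N : Matrix (Fin m) (Fin m) ℝ}
    (hL : IsTriangularFactor L N) (hN : N.PosDef) (r : Fin m → ℝ) :
    (factorSolve L r).val = N⁻¹ *ᵥ r := by
  have h := mulVec_factorSolve L hL.1 (hL.diag_ne_zero hN) r
  rw [hL.2] at h
  conv_rhs => rw [← h]
  rw [inv_mulVec_mulVec_of_posDef hN]

/-! ### Convergence of the preconditioned conjugate gradient method -/

/-- The relations between the parts of an iterate of the method for `M d = h` with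
preconditioner `N` that yield linear convergence. Only successive directions are related. -/
structure IsPCGIterate {m : ℕ} (M N : Matrix (Fin m) (Fin m) ℝ) (h : Fin m → ℝ)
    (st : Counted.PCGState m) : Prop where
  residual : st.r = h - M *ᵥ st.d
  rho_eq : st.ρ = st.r ⬝ᵥ N⁻¹ *ᵥ st.r
  direction_residual : st.p ⬝ᵥ st.r = st.ρ
  conjugate : (N⁻¹ *ᵥ st.r) ⬝ᵥ M *ᵥ st.p = st.p ⬝ᵥ M *ᵥ st.p
  curvature_le : st.p ⬝ᵥ M *ᵥ st.p ≤ (N⁻¹ *ᵥ st.r) ⬝ᵥ M *ᵥ (N⁻¹ *ᵥ st.r)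

theorem isPCGIterate_pcgInit {m : ℕ} {M N L : Matrix (Fin m) (Fin m) ℝ}
    (hN : N.PosDef) (hL : IsTriangularFactor L N) (h : Fin m → ℝ) :
    IsPCGIterate M N h (Counted.pcgInit L h).val := by
  have hs := Counted.val_factorSolve hL hN h
  have h0 : (fun _ => 0 : Fin m → ℝ) = 0 := rfl
  constructor <;> simp [Counted.pcgInit, hs, h0, dotProduct_comm h]

section Step

variable {m n : ℕ} {A : Matrix (Fin m) (Fin n) ℝ} {q : Fin n → ℝ}
  {N L : Matrix (Fin m) (Fin m) ℝ} {h : Fin m → ℝ} {st : Counted.PCGState m}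

/-- pᵀr = ρ > 0 forces p ≠ 0, so the step length is never a division by zero. -/
theorem IsPCGIterate.curvature_pos {M : Matrix (Fin m) (Fin m) ℝ} (hM : M.PosDef)
    (hst : IsPCGIterate M N h st) (hρ : 0 < st.ρ) : 0 < st.p ⬝ᵥ M *ᵥ st.p := by
  have hp : st.p ≠ 0 := by
    intro hp
    have := hst.direction_residual
    rw [hp, zero_dotProduct] at this
    exact hρ.ne this
  simpa using hM.dotProduct_mulVec_pos hp

/-- Exact line search makes the new residual r' orthogonal to p, and relation `conjugate` makes it
orthogonal to N⁻¹ r as well. By symmetry of N⁻¹ this yields s'ᵀr = 0, hence s'ᵀMp = -βκ: precisely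
what makes p' = s' + βp conjugate to p. -/
theorem IsPCGIterate.pcgStep (hM : (A * Matrix.diagonal q * Aᵀ).PosDef) (hN : N.PosDef)
    (hL : IsTriangularFactor L N) (hst : IsPCGIterate (A * Matrix.diagonal q * Aᵀ) N h st)
    (hρ : 0 < st.ρ) :
    IsPCGIterate (A * Matrix.diagonal q * Aᵀ) N h (Counted.pcgStep A q L st).val := by
  set M := A * Matrix.diagonal q * Aᵀ with hMdef
  have hk := hst.curvature_pos hM hρ
  obtain ⟨hr, hρe, hpr, hconj, hle⟩ := hst
  set κ := st.p ⬝ᵥ M *ᵥ st.p with hκ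
  set α := st.ρ / κ with hα
  set r' := st.r + (-α) • M *ᵥ st.p with hr'
  set s' := N⁻¹ *ᵥ r' with hs'
  set β := (r' ⬝ᵥ s') / st.ρ with hβ
  set p' := s' + β • st.p with hp'
  have hval : (Counted.pcgStep A q L st).val = ⟨st.d + α • st.p, r', p', r' ⬝ᵥ s'⟩ := by
    simp only [Counted.pcgStep, Counted.val_bind, Counted.val_pure, Counted.val_applyNormal,
      Counted.val_dot, Counted.val_div, Counted.val_axpy, Counted.val_sub, zero_sub,
      Counted.val_factorSolve hL hN]
    rfl
  have hακ : α * κ = st.ρ := div_mul_cancel₀ _ hk.ne'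
  have hβρ : β * st.ρ = r' ⬝ᵥ s' := div_mul_cancel₀ _ hρ.ne'
  have hα0 : 0 < α := div_pos hρ hk
  have hpr' : st.p ⬝ᵥ r' = 0 := by
    rw [hr', dotProduct_add, dotProduct_smul, hpr, ← hκ, smul_eq_mul]
    linarith
  have hsr' : (N⁻¹ *ᵥ st.r) ⬝ᵥ r' = 0 := by
    rw [hr', dotProduct_add, dotProduct_smul, hconj, dotProduct_comm, ← hρe, smul_eq_mul]
    linarith
  have hs'r : s' ⬝ᵥ st.r = 0 := by
    rw [hs', dotProduct_comm, dotProduct_mulVec_comm_of_isHermitian hN.inv.isHermitian,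
      dotProduct_comm, hsr']
  have hs'p : s' ⬝ᵥ M *ᵥ st.p = -(β * κ) := by
    have h1 : s' ⬝ᵥ r' = -α * (s' ⬝ᵥ M *ᵥ st.p) := by
      conv_lhs => rw [hr', dotProduct_add, dotProduct_smul, hs'r, zero_add, smul_eq_mul]
    rw [dotProduct_comm, ← hβρ, ← hακ] at h1
    apply mul_left_cancel₀ hα0.ne'
    linarith
  have hpp' : p' ⬝ᵥ M *ᵥ st.p = 0 := by
    rw [hp', add_dotProduct, smul_dotProduct, hs'p, ← hκ, smul_eq_mul]
    ring
  have hconj' : s' ⬝ᵥ M *ᵥ p' = p' ⬝ᵥ M *ᵥ p' := by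
    nth_rw 2 [hp']
    rw [add_dotProduct, smul_dotProduct,
      dotProduct_mulVec_comm_of_isHermitian hM.isHermitian st.p p', hpp']
    simp
  rw [hval]
  refine ⟨?_, hs' ▸ rfl, ?_, hconj', ?_⟩
  · simp only [hr', hr, Matrix.mulVec_add, Matrix.mulVec_smul]
    module
  · change p' ⬝ᵥ r' = r' ⬝ᵥ s'
    rw [hp', add_dotProduct, smul_dotProduct, hpr', dotProduct_comm]
    simp
  · change p' ⬝ᵥ M *ᵥ p' ≤ s' ⬝ᵥ M *ᵥ s'
    -- The curvature equals s'ᵀMs' - β²κ: conjugation can only lower it.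
    rw [← hconj', hp', Matrix.mulVec_add, Matrix.mulVec_smul, dotProduct_add, dotProduct_smul,
      hs'p, smul_eq_mul]
    nlinarith [mul_nonneg (mul_self_nonneg β) hk.le]

/-- One step reduces the energy `⟨r, M⁻¹ r⟩` of the error by `1 / (a b)` of its value, if the
preconditioner satisfies `a⁻¹ N ≤ M ≤ b N`. -/
theorem IsPCGIterate.energy_pcgStep_le (hM : (A * Matrix.diagonal q * Aᵀ).PosDef)
    (hN : N.PosDef) {a b : ℝ} (ha : 0 < a) (hb : 0 < b)
    (hlow : ∀ y, y ⬝ᵥ N *ᵥ y ≤ a * (y ⬝ᵥ (A * Matrix.diagonal q * Aᵀ) *ᵥ y))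
    (hupp : ∀ y, y ⬝ᵥ (A * Matrix.diagonal q * Aᵀ) *ᵥ y ≤ b * (y ⬝ᵥ N *ᵥ y))
    (hst : IsPCGIterate (A * Matrix.diagonal q * Aᵀ) N h st) (hρ : 0 < st.ρ) :
    (Counted.pcgStep A q L st).val.r ⬝ᵥ
        (A * Matrix.diagonal q * Aᵀ)⁻¹ *ᵥ (Counted.pcgStep A q L st).val.r ≤
      (1 - 1 / (a * b)) * (st.r ⬝ᵥ (A * Matrix.diagonal q * Aᵀ)⁻¹ *ᵥ st.r) := by
  set M := A * Matrix.diagonal q * Aᵀ with hMdef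
  have hk := hst.curvature_pos hM hρ
  obtain ⟨hr, hρe, hpr, hconj, hle⟩ := hst
  -- The curvature is at most that of the steepest descent direction N⁻¹ r, which `hupp` bounds by b
  -- ρ.
  have hkb : st.p ⬝ᵥ M *ᵥ st.p ≤ b * st.ρ := by
    refine (hle.trans (hupp _)).trans_eq ?_
    rw [mulVec_inv_mulVec_of_posDef hN, hρe, dotProduct_comm]
  have hE : st.r ⬝ᵥ M⁻¹ *ᵥ st.r ≤ a * st.ρ :=
    hρe ▸ inv_quadForm_le_of_quadForm_le hN hM ha hlow st.r
  set κ := st.p ⬝ᵥ M *ᵥ st.p with hκ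
  have hr' : (Counted.pcgStep A q L st).val.r = st.r - (st.ρ / κ) • M *ᵥ st.p := by
    simp [Counted.pcgStep, ← hMdef, ← hκ, sub_eq_add_neg]
  set E := st.r ⬝ᵥ M⁻¹ *ᵥ st.r with hEdef
  -- Exact line search lowers the energy by ρ²/κ, and E ≤ aρ with κ ≤ bρ turns this into the
  -- fraction 1/(ab) of E.
  have hexp : (Counted.pcgStep A q L st).val.r ⬝ᵥ
      M⁻¹ *ᵥ (Counted.pcgStep A q L st).val.r = E - st.ρ ^ 2 / κ := by
    have hcross : (M *ᵥ st.p) ⬝ᵥ M⁻¹ *ᵥ st.r = st.ρ := by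
      rw [dotProduct_mulVec_comm_of_isHermitian hM.inv.isHermitian,
        inv_mulVec_mulVec_of_posDef hM, dotProduct_comm, hpr]
    rw [hr', Matrix.mulVec_sub, Matrix.mulVec_smul, inv_mulVec_mulVec_of_posDef hM]
    simp only [dotProduct_sub, sub_dotProduct, smul_dotProduct, dotProduct_smul, smul_eq_mul,
      hcross, dotProduct_comm st.r st.p, hpr, dotProduct_comm (M *ᵥ st.p) st.p, ← hκ, ← hEdef]
    field_simp
    ring
  rw [hexp]
  have h1 : E / (a * b) ≤ st.ρ ^ 2 / κ := by
    rw [div_le_div_iff₀ (mul_pos ha hb) hk]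
    calc E * κ ≤ (a * st.ρ) * (b * st.ρ) :=
          mul_le_mul hE hkb hk.le (mul_pos ha hρ).le
      _ = st.ρ ^ 2 * (a * b) := by ring
  have h2 : (1 - 1 / (a * b)) * E = E - E / (a * b) := by ring
  linarith

/-- If `K` energy reductions suffice for the stopping criterion, then the loop stops within `K`
steps, with a residual that passes the criterion and a cost that does not depend on the
admitted number of steps. -/
theorem IsPCGIterate.exists_pcgLoop_eq (hM : (A * Matrix.diagonal q * Aᵀ).PosDef)
    (hN : N.PosDef) (hL : IsTriangularFactor L N) {a b : ℝ} (ha : 0 < a) (hb : 0 < b)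
    (hab : 1 ≤ a * b)
    (hlow : ∀ y, y ⬝ᵥ N *ᵥ y ≤ a * (y ⬝ᵥ (A * Matrix.diagonal q * Aᵀ) *ᵥ y))
    (hupp : ∀ y, y ⬝ᵥ (A * Matrix.diagonal q * Aᵀ) *ᵥ y ≤ b * (y ⬝ᵥ N *ᵥ y))
    {ε : ℝ} (K : ℕ) (st : Counted.PCGState m)
    (hst : IsPCGIterate (A * Matrix.diagonal q * Aᵀ) N h st)
    (hK : 25 * b * ((1 - 1 / (a * b)) ^ K *
      (st.r ⬝ᵥ (A * Matrix.diagonal q * Aᵀ)⁻¹ *ᵥ st.r)) ≤ ε ^ 2) :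
    ∃ (d : Fin m → ℝ) (T : ℕ),
      (∀ maxIter, K ≤ maxIter → Counted.pcgLoop A q L ε maxIter st = ⟨some d, T⟩) ∧
      T ≤ 3 + K * (4 * m * n + n + 4 * m ^ 2 + 14 * m + 6) ∧
      25 * ((h - (A * Matrix.diagonal q * Aᵀ) *ᵥ d) ⬝ᵥ
        N⁻¹ *ᵥ (h - (A * Matrix.diagonal q * Aᵀ) *ᵥ d)) ≤ ε ^ 2 := by
  induction K generalizing st with
  | zero =>
    -- The test measures the residual in N⁻¹, the energy in M⁻¹; M ≤ bN costs the factor b.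
    have hsmall : 25 * st.ρ ≤ ε * ε := by
      have := inv_quadForm_le_of_quadForm_le hM hN hb hupp st.r
      rw [← hst.rho_eq] at this
      rw [pow_zero, one_mul] at hK
      nlinarith
    refine ⟨st.d, 3, fun k _ => ?_, by simp, ?_⟩
    · unfold Counted.pcgLoop
      simp [bind, pure, Counted.mul, Counted.le, hsmall]
    · rw [← hst.residual, ← hst.rho_eq, sq]
      exact hsmall
  | succ K ih =>
    by_cases hsmall : 25 * st.ρ ≤ ε * ε
    · refine ⟨st.d, 3, fun k _ => ?_, by simp, ?_⟩
      · unfold Counted.pcgLoop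
        simp [bind, pure, Counted.mul, Counted.le, hsmall]
      · rw [← hst.residual, ← hst.rho_eq, sq]
        exact hsmall
    -- A failed test forces ρ > 0, so the next step cannot break down.
    · have hρ : 0 < st.ρ := by
        push Not at hsmall
        linarith [mul_self_nonneg ε]
      have h1 : 0 ≤ 1 - 1 / (a * b) := by
        rw [sub_nonneg]
        exact div_le_one_of_le₀ hab (mul_pos ha hb).le
      obtain ⟨d, T, hrun, hT, hres⟩ := ih _ (hst.pcgStep hM hN hL hρ) (by
        refine le_trans ?_ hK
        rw [pow_succ, mul_assoc (_ ^ K)]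
        exact mul_le_mul_of_nonneg_left (mul_le_mul_of_nonneg_left
          (hst.energy_pcgStep_le hM hN ha hb hlow hupp hρ) (pow_nonneg h1 K)) (by positivity))
      refine ⟨d, 3 + ((4 * m * n + n + 4 * m ^ 2 + 14 * m + 3) + T), fun k hk => ?_, ?_, hres⟩
      · obtain ⟨k, rfl⟩ := Nat.exists_eq_add_of_le' (Nat.one_le_of_lt hk)
        have hrun' := hrun k (by omega)
        unfold Counted.pcgLoop
        simp only [bind, Counted.mul, Counted.le, hsmall, decide_false, Bool.false_eq_true,
          if_false, hrun', Counted.ops_pcgStep]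
        congr 1
        ring
      · rw [add_mul]
        omega

end Step

/-! ### The Euclidean norm of coordinate vectors -/

theorem euclNorm_nonneg {n : ℕ} (v : Fin n → ℝ) : 0 ≤ euclNorm v := norm_nonneg _

theorem euclNorm_sq {n : ℕ} (v : Fin n → ℝ) : euclNorm v ^ 2 = v ⬝ᵥ v := by
  rw [euclNorm, EuclideanSpace.real_norm_sq_eq]
  simp [dotProduct, sq]

theorem euclNorm_add_le {n : ℕ} (u v : Fin n → ℝ) :
    euclNorm (u + v) ≤ euclNorm u + euclNorm v := by
  rw [euclNorm, WithLp.toLp_add]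
  exact norm_add_le _ _

theorem euclNorm_mul_le {n : ℕ} {d : Fin n → ℝ} {k : ℝ} (hk : 0 ≤ k) (hd : ∀ j, |d j| ≤ k)
    (a : Fin n → ℝ) : euclNorm (d * a) ≤ k * euclNorm a := by
  rw [← sq_le_sq₀ (euclNorm_nonneg _) (mul_nonneg hk (euclNorm_nonneg _)), mul_pow, euclNorm_sq,
    euclNorm_sq, dotProduct, dotProduct, Finset.mul_sum]
  refine Finset.sum_le_sum fun j _ => ?_
  have := mul_le_mul_of_nonneg_right (sq_le_sq' (abs_le.1 (hd j)).1 (abs_le.1 (hd j)).2)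
    (mul_self_nonneg (a j))
  simp only [Pi.mul_apply]
  linarith

theorem euclNorm_transpose_mulVec_le {m n : ℕ} (A : Matrix (Fin m) (Fin n) ℝ) (y : Fin m → ℝ) :
    euclNorm (Aᵀ *ᵥ y) ≤ ‖A‖ * euclNorm y := by
  have h := Matrix.l2_opNorm_mulVec Aᵀ (WithLp.toLp 2 y)
  rw [← Matrix.conjTranspose_eq_transpose_of_trivial, Matrix.l2_opNorm_conjTranspose] at h
  exact h

/-! ### Normal matrices and projections -/

section Projection

variable {m n : ℕ} {B : Matrix (Fin m) (Fin n) ℝ}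

theorem kerProj_mulVec (B : Matrix (Fin m) (Fin n) ℝ) (a : Fin n → ℝ) :
    kerProj B *ᵥ a = a - Bᵀ *ᵥ (B * Bᵀ)⁻¹ *ᵥ B *ᵥ a := by
  rw [kerProj, Matrix.sub_mulVec, Matrix.one_mulVec, ← Matrix.mulVec_mulVec,
    ← Matrix.mulVec_mulVec]

theorem mulVec_kerProj_mulVec (hB : (B * Bᵀ).PosDef) (a : Fin n → ℝ) :
    B *ᵥ kerProj B *ᵥ a = 0 := by
  rw [kerProj_mulVec, Matrix.mulVec_sub, Matrix.mulVec_mulVec, mulVec_inv_mulVec_of_posDef hB,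
    sub_self]

theorem euclNorm_transpose_mulVec_sq (B : Matrix (Fin m) (Fin n) ℝ) (y : Fin m → ℝ) :
    euclNorm (Bᵀ *ᵥ y) ^ 2 = y ⬝ᵥ (B * Bᵀ) *ᵥ y := by
  rw [euclNorm_sq, ← Matrix.mulVec_mulVec, Matrix.dotProduct_mulVec y, Matrix.mulVec_transpose]

theorem euclNorm_transpose_inv_mulVec_sq (hB : (B * Bᵀ).PosDef) (r : Fin m → ℝ) :
    euclNorm (Bᵀ *ᵥ (B * Bᵀ)⁻¹ *ᵥ r) ^ 2 = r ⬝ᵥ (B * Bᵀ)⁻¹ *ᵥ r := by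
  rw [euclNorm_transpose_mulVec_sq, mulVec_inv_mulVec_of_posDef hB, dotProduct_comm]

/-- Pythagoras: the subtracted term is the squared norm of the component in the row space of B.
Nonnegativity of either component gives the two bounds that follow. -/
theorem euclNorm_kerProj_mulVec_sq (hB : (B * Bᵀ).PosDef) (a : Fin n → ℝ) :
    euclNorm (kerProj B *ᵥ a) ^ 2 =
      euclNorm a ^ 2 - (B *ᵥ a) ⬝ᵥ (B * Bᵀ)⁻¹ *ᵥ B *ᵥ a := by
  rw [euclNorm_sq]
  nth_rw 1 [kerProj_mulVec]
  rw [sub_dotProduct, Matrix.mulVec_transpose, ← Matrix.dotProduct_mulVec,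
    mulVec_kerProj_mulVec hB, dotProduct_zero, sub_zero, kerProj_mulVec, dotProduct_sub,
    ← euclNorm_sq, Matrix.mulVec_transpose, dotProduct_comm a (Matrix.vecMul _ _),
    ← Matrix.dotProduct_mulVec, dotProduct_comm (_ *ᵥ _) (B *ᵥ a)]

theorem quadForm_inv_mulVec_le (hB : (B * Bᵀ).PosDef) (a : Fin n → ℝ) :
    (B *ᵥ a) ⬝ᵥ (B * Bᵀ)⁻¹ *ᵥ B *ᵥ a ≤ euclNorm a ^ 2 := by
  have := euclNorm_kerProj_mulVec_sq hB a
  nlinarith [sq_nonneg (euclNorm (kerProj B *ᵥ a))]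

theorem euclNorm_kerProj_mulVec_le (hB : (B * Bᵀ).PosDef) (a : Fin n → ℝ) :
    euclNorm (kerProj B *ᵥ a) ≤ euclNorm a := by
  rw [← sq_le_sq₀ (euclNorm_nonneg _) (euclNorm_nonneg _), euclNorm_kerProj_mulVec_sq hB]
  simpa using hB.inv.posSemidef.dotProduct_mulVec_nonneg (B *ᵥ a)

end Projection

section NormalMatrix

variable {m n : ℕ} (A : Matrix (Fin m) (Fin n) ℝ)

theorem normalMatrix_eq_mul_transpose (w : Fin n → ℝ) :
    normalMatrix A w = A * Matrix.diagonal w * (A * Matrix.diagonal w)ᵀ := by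
  rw [normalMatrix, sq, Matrix.transpose_mul, Matrix.diagonal_transpose]
  simp only [Matrix.mul_assoc]

theorem normalMatrix_eq_diagonal_mul_self (w : Fin n → ℝ) :
    normalMatrix A w = A * Matrix.diagonal (w * w) * Aᵀ := by
  rw [normalMatrix, sq, Matrix.diagonal_mul_diagonal]
  rfl

theorem mul_diagonal_mulVec (w a : Fin n → ℝ) : (A * Matrix.diagonal w) *ᵥ a = A *ᵥ (w * a) := by
  rw [← Matrix.mulVec_mulVec]
  congr 1
  ext j
  simp [Matrix.mulVec_diagonal]

theorem transpose_mul_diagonal_mulVec (w : Fin n → ℝ) (y : Fin m → ℝ) :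
    (A * Matrix.diagonal w)ᵀ *ᵥ y = w * (Aᵀ *ᵥ y) := by
  rw [Matrix.transpose_mul, Matrix.diagonal_transpose, ← Matrix.mulVec_mulVec]
  ext j
  simp [Matrix.mulVec_diagonal]

theorem quadForm_normalMatrix (w : Fin n → ℝ) (y : Fin m → ℝ) :
    y ⬝ᵥ normalMatrix A w *ᵥ y = euclNorm (w * (Aᵀ *ᵥ y)) ^ 2 := by
  rw [normalMatrix_eq_mul_transpose, ← euclNorm_transpose_mulVec_sq, transpose_mul_diagonal_mulVec]

variable {A}

theorem normalMatrix_posDef (hA : A.rank = m) {w : Fin n → ℝ} (hw : ∀ j, 0 < w j) :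
    (normalMatrix A w).PosDef := by
  have hinj : Function.Injective A.vecMul := by
    rw [Matrix.vecMul_injective_iff, linearIndependent_iff_card_eq_finrank_span,
      Fintype.card_fin, Set.finrank, ← Matrix.rank_eq_finrank_span_row, hA]
  have h := (Matrix.PosDef.diagonal (d := w * w)
    fun j => mul_pos (hw j) (hw j)).mul_mul_conjTranspose_same hinj
  rwa [Matrix.conjTranspose_eq_transpose_of_trivial, ← normalMatrix_eq_diagonal_mul_self] at h

end NormalMatrix

/-! ### The delayed scaling point -/

theorem val_delayedPoint {n : ℕ} (ν : ℝ) (x z : Fin n → ℝ) :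
    (delayedPoint ν x z).val = fun j => if ν ≤ x j then z j else x j := by
  ext j
  simp [delayedPoint]

theorem thresholdedDist_nonneg {n : ℕ} (x : Fin n → ℝ) (ν : ℝ) (y z : Fin n → ℝ) :
    0 ≤ thresholdedDist x ν y z := Real.sqrt_nonneg _

theorem thresholdedDist_sq {n : ℕ} (x : Fin n → ℝ) (ν : ℝ) (y z : Fin n → ℝ) :
    thresholdedDist x ν y z ^ 2 =
      (∑ j with ν ≤ x j, ((x j)⁻¹ * (y j - z j)) ^ 2) + ∑ j with x j < ν, (y j - z j) ^ 2 :=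
  Real.sq_sqrt (add_nonneg (Finset.sum_nonneg fun _ _ => sq_nonneg _)
    (Finset.sum_nonneg fun _ _ => sq_nonneg _))

theorem abs_inv_mul_sub_le_thresholdedDist {n : ℕ} {x : Fin n → ℝ} {ν : ℝ} (y z : Fin n → ℝ)
    {j : Fin n} (hj : ν ≤ x j) : |(x j)⁻¹ * (y j - z j)| ≤ thresholdedDist x ν y z := by
  refine abs_le_of_sq_le_sq ?_ (thresholdedDist_nonneg _ _ _ _)
  rw [thresholdedDist_sq]
  have h1 := Finset.single_le_sum (f := fun j => ((x j)⁻¹ * (y j - z j)) ^ 2)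
    (fun i _ => sq_nonneg _)
    (Finset.mem_filter.2 ⟨Finset.mem_univ j, hj⟩ : j ∈ Finset.univ.filter fun j => ν ≤ x j)
  have h2 : 0 ≤ ∑ j with x j < ν, (y j - z j) ^ 2 := Finset.sum_nonneg fun _ _ => sq_nonneg _
  linarith

theorem abs_sub_le_thresholdedDist {n : ℕ} {x : Fin n → ℝ} {ν : ℝ} (y z : Fin n → ℝ)
    {j : Fin n} (hj : x j < ν) : |y j - z j| ≤ thresholdedDist x ν y z := by
  refine abs_le_of_sq_le_sq ?_ (thresholdedDist_nonneg _ _ _ _)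
  rw [thresholdedDist_sq]
  have h1 := Finset.single_le_sum (f := fun j => (y j - z j) ^ 2)
    (fun i _ => sq_nonneg _)
    (Finset.mem_filter.2 ⟨Finset.mem_univ j, hj⟩ : j ∈ Finset.univ.filter fun j => x j < ν)
  have h2 : 0 ≤ ∑ j with ν ≤ x j, ((x j)⁻¹ * (y j - z j)) ^ 2 :=
    Finset.sum_nonneg fun _ _ => sq_nonneg _
  linarith

section DelayedPoint

variable {n : ℕ} {x z : Fin n → ℝ} {ν : ℝ}

theorem delayedPoint_pos (hx : ∀ j, 0 < x j) (hz : ∀ j, 0 < z j) (j : Fin n) :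
    0 < (delayedPoint ν x z).val j := by
  rw [val_delayedPoint]
  dsimp only
  split_ifs
  exacts [hz j, hx j]

/-- w differs from x only where x_j ≥ ν, and there the distance is relative. -/
theorem abs_delayedPoint_div_sub_one_le (hx : ∀ j, 0 < x j) (j : Fin n) :
    |(delayedPoint ν x z).val j / x j - 1| ≤ thresholdedDist x ν z x := by
  rw [val_delayedPoint]
  dsimp only
  split_ifs with h
  · refine le_of_eq_of_le (congrArg _ ?_) (abs_inv_mul_sub_le_thresholdedDist z x h)
    have := (hx j).ne'
    field_simp
  · rw [div_self (hx j).ne', sub_self, abs_zero]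
    exact thresholdedDist_nonneg _ _ _ _

/-- w differs from z only where x_j < ν, and there the distance is absolute. -/
theorem abs_delayedPoint_sub_le (j : Fin n) :
    |(delayedPoint ν x z).val j - z j| ≤ thresholdedDist x ν z x := by
  rw [val_delayedPoint]
  dsimp only
  split_ifs with h
  · rw [sub_self, abs_zero]
    exact thresholdedDist_nonneg _ _ _ _
  · rw [abs_sub_comm]
    exact abs_sub_le_thresholdedDist z x (not_le.1 h)

end DelayedPoint

/-- If `w` is uniformly `√lamz / (2 ‖A‖)`-close to `z`, then `M_Z / 4 ≤ M_W ≤ 9 M_Z / 4`. -/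
theorem quadForm_normalMatrix_bounds {m n : ℕ} {A : Matrix (Fin m) (Fin n) ℝ}
    {w z : Fin n → ℝ} {k lamz : ℝ} (hk : 0 ≤ k) (hlam : 0 ≤ lamz) (hwz : ∀ j, |w j - z j| ≤ k)
    (hpsd : (normalMatrix A z - lamz • (1 : Matrix (Fin m) (Fin m) ℝ)).PosSemidef)
    (hkA : k * (2 * ‖A‖) ≤ Real.sqrt lamz) (y : Fin m → ℝ) :
    y ⬝ᵥ normalMatrix A z *ᵥ y ≤ 4 * (y ⬝ᵥ normalMatrix A w *ᵥ y) ∧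
      y ⬝ᵥ normalMatrix A w *ᵥ y ≤ 9 / 4 * (y ⬝ᵥ normalMatrix A z *ᵥ y) := by
  have h1 : lamz * euclNorm y ^ 2 ≤ euclNorm (z * (Aᵀ *ᵥ y)) ^ 2 := by
    have h := hpsd.dotProduct_mulVec_nonneg y
    rw [Matrix.sub_mulVec, Matrix.smul_mulVec, Matrix.one_mulVec, dotProduct_sub, dotProduct_smul,
      star_trivial, quadForm_normalMatrix, ← euclNorm_sq, smul_eq_mul] at h
    linarith
  have h2 : Real.sqrt lamz * euclNorm y ≤ euclNorm (z * (Aᵀ *ᵥ y)) := by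
    rwa [← sq_le_sq₀ (mul_nonneg (Real.sqrt_nonneg _) (euclNorm_nonneg _)) (euclNorm_nonneg _),
      mul_pow, Real.sq_sqrt hlam]
  -- Replacing z by w perturbs Z Aᵀ y by at most half its norm; squaring the factors 1/2 and 3/2
  -- gives 1/4 and 9/4.
  have h3 : k * euclNorm (Aᵀ *ᵥ y) ≤ euclNorm (z * (Aᵀ *ᵥ y)) / 2 := by
    have ha := mul_le_mul_of_nonneg_left (euclNorm_transpose_mulVec_le A y) hk
    have hb := mul_le_mul_of_nonneg_right hkA (euclNorm_nonneg y)
    linarith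
  have h4 := (euclNorm_mul_le hk hwz (Aᵀ *ᵥ y)).trans h3
  have h5 := (euclNorm_mul_le hk (fun j => (abs_sub_comm (z j) (w j)).trans_le (hwz j))
    (Aᵀ *ᵥ y)).trans h3
  have h6 := euclNorm_add_le ((fun j => w j - z j) * (Aᵀ *ᵥ y)) (z * (Aᵀ *ᵥ y))
  have h7 := euclNorm_add_le ((fun j => z j - w j) * (Aᵀ *ᵥ y)) (w * (Aᵀ *ᵥ y))
  rw [← add_mul, show (fun j => w j - z j) + z = w by ext j; simp] at h6
  rw [← add_mul, show (fun j => z j - w j) + w = z by ext j; simp] at h7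
  have hw0 := euclNorm_nonneg (w * (Aᵀ *ᵥ y))
  have hz0 := euclNorm_nonneg (z * (Aᵀ *ᵥ y))
  simp only [quadForm_normalMatrix]
  constructor <;> nlinarith

/-! ### Accuracy of the computed direction -/

theorem barrierResidual_apply {n : ℕ} (c x : Fin n → ℝ) (μ : ℝ) (j : Fin n) :
    barrierResidual c x μ j = x j * c j / μ - 1 := by
  simp [barrierResidual, Matrix.mulVec_diagonal]
  ring

section Accuracy

variable {m n : ℕ} {A : Matrix (Fin m) (Fin n) ℝ} {c x w : Fin n → ℝ} {μ : ℝ}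

/-- The error of the direction `W² Aᵀ d - W² g`, `g = (1/μ) c - X⁻¹ e`, in terms of the residual
of `d`. -/
theorem inv_mul_newtonDirection_sub (hA : A.rank = m) (hx : ∀ j, 0 < x j) (hw : ∀ j, 0 < w j)
    (d : Fin m → ℝ) :
    (fun j => (x j)⁻¹ * (newtonDirection A c x μ
        - fun j => w j * w j * (Aᵀ *ᵥ d) j - w j * w j * (c j / μ - 1 / x j)) j) =
      (fun j => w j / x j) *
        (kerProj (A * Matrix.diagonal w) *ᵥ ((fun j => w j / x j - x j / w j) *
            (kerProj (A * Matrix.diagonal x) *ᵥ barrierResidual c x μ)) +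
          (A * Matrix.diagonal w)ᵀ *ᵥ (normalMatrix A w)⁻¹ *ᵥ
            (A *ᵥ (fun j => w j * w j * (c j / μ - 1 / x j)) - normalMatrix A w *ᵥ d)) := by
  have hMx := normalMatrix_posDef hA hx
  have hMw := normalMatrix_posDef hA hw
  set u : Fin n → ℝ := fun j => w j * w j * (c j / μ - 1 / x j) with hu
  set v := barrierResidual c x μ with hv
  set p := kerProj (A * Matrix.diagonal x) *ᵥ v with hp
  set a : Fin n → ℝ := (fun j => w j / x j - x j / w j) * p with ha
  set y := (normalMatrix A x)⁻¹ *ᵥ (A * Matrix.diagonal x) *ᵥ v with hy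
  have hpy : p = v - x * (Aᵀ *ᵥ y) := by
    rw [hp, kerProj_mulVec, ← normalMatrix_eq_mul_transpose, ← hy, transpose_mul_diagonal_mulVec]
  have hAp : A *ᵥ (x * p) = 0 := by
    rw [← mul_diagonal_mulVec, hp, mulVec_kerProj_mulVec]
    rwa [← normalMatrix_eq_mul_transpose]
  -- Here u = W D v and v = p + X Aᵀ y. As A X p = 0, subtracting X p from W D p is free under A; it
  -- turns D p into (D - D⁻¹) p, which is of first order in w - x.
  have hAa : A *ᵥ (w * a) = A *ᵥ u - normalMatrix A w *ᵥ y := by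
    have hwa : w * a = u - w * (w * (Aᵀ *ᵥ y)) - x * p := by
      ext j
      have h1 := (hx j).ne'
      have h2 := (hw j).ne'
      simp only [ha, hu, Pi.mul_apply, Pi.sub_apply, hpy, hv, barrierResidual_apply]
      field_simp
    rw [hwa, Matrix.mulVec_sub, Matrix.mulVec_sub, hAp, sub_zero, normalMatrix_eq_mul_transpose,
      ← Matrix.mulVec_mulVec, transpose_mul_diagonal_mulVec, mul_diagonal_mulVec]
  rw [kerProj_mulVec, ← normalMatrix_eq_mul_transpose, mul_diagonal_mulVec, hAa]
  simp only [Matrix.mulVec_sub, inv_mulVec_mulVec_of_posDef hMw, transpose_mul_diagonal_mulVec]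
  have hnewton : newtonDirection A c x μ = -(x * p) := by
    ext j
    rw [newtonDirection, ← hv, ← hp, Pi.neg_apply, Matrix.mulVec_diagonal, Pi.neg_apply,
      Pi.mul_apply]
  rw [hnewton]
  ext j
  have h1 := (hx j).ne'
  have h2 := (hw j).ne'
  simp only [Pi.add_apply, Pi.sub_apply, Pi.mul_apply, Pi.neg_apply, ha, hpy, hv,
    barrierResidual_apply]
  field_simp
  ring

/-- Error budget: the change of scaling and the inexact solve get 2ε/5 each, and the outer factor
w_j / x_j ≤ 5/4 brings the sum to ε. -/
theorem scaledNorm_newtonDirection_sub_le (hA : A.rank = m) (hx : ∀ j, 0 < x j)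
    (hw : ∀ j, 0 < w j) {k ε : ℝ} (hk0 : 0 ≤ k) (hk : k ≤ 1 / 4) (hε : 0 < ε)
    (hkw : ∀ j, |w j / x j - 1| ≤ k) (hkε : k * (6 * proximity A c x μ) ≤ ε) {d : Fin m → ℝ}
    {r : Fin m → ℝ}
    (hr : r = A *ᵥ (fun j => w j * w j * (c j / μ - 1 / x j)) - normalMatrix A w *ᵥ d)
    (hrε : 25 * (r ⬝ᵥ (normalMatrix A w)⁻¹ *ᵥ r) ≤ 4 * ε ^ 2) :
    scaledNorm x (newtonDirection A c x μ
        - fun j => w j * w j * (Aᵀ *ᵥ d) j - w j * w j * (c j / μ - 1 / x j)) ≤ ε := by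
  have hMw := normalMatrix_posDef hA hw
  rw [normalMatrix_eq_mul_transpose] at hMw
  have hD : ∀ j, |w j / x j| ≤ 5 / 4 := fun j => by
    have := abs_le.1 (hkw j)
    rw [abs_le]
    constructor <;> linarith
  have hDinv : ∀ j, |w j / x j - x j / w j| ≤ 12 / 5 * k := fun j => by
    have h1 : x j / w j ≤ 4 / 3 := by
      have h2 := (abs_le.1 (hkw j)).1
      have h3 : 3 / 4 ≤ w j / x j := by linarith
      rw [le_div_iff₀ (hx j)] at h3
      rw [div_le_iff₀ (hw j)]
      linarith
    have h4 : 0 < x j / w j := div_pos (hx j) (hw j)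
    have h5 : w j / x j - x j / w j = (w j / x j - 1) * (1 + x j / w j) := by
      have h1 := (hx j).ne'
      have h2 := (hw j).ne'
      field_simp
      ring
    rw [h5, abs_mul, abs_of_pos (by linarith : 0 < 1 + x j / w j)]
    calc |w j / x j - 1| * (1 + x j / w j) ≤ k * (12 / 5) :=
          mul_le_mul (hkw j) (by linarith) (by linarith) hk0
      _ = 12 / 5 * k := mul_comm _ _
  rw [scaledNorm, inv_mul_newtonDirection_sub hA hx hw, ← hr]
  set p := kerProj (A * Matrix.diagonal x) *ᵥ barrierResidual c x μ with hp
  have h1 := (euclNorm_kerProj_mulVec_le hMw ((fun j => w j / x j - x j / w j) * p)).trans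
    (euclNorm_mul_le (by linarith) hDinv p)
  have h2 : euclNorm ((A * Matrix.diagonal w)ᵀ *ᵥ (normalMatrix A w)⁻¹ *ᵥ r) ≤ 2 / 5 * ε := by
    rw [← sq_le_sq₀ (euclNorm_nonneg _) (by positivity), normalMatrix_eq_mul_transpose,
      euclNorm_transpose_inv_mulVec_sq hMw, ← normalMatrix_eq_mul_transpose]
    linarith
  have hprox : euclNorm p = proximity A c x μ := rfl
  rw [hprox] at h1
  refine (euclNorm_mul_le (by norm_num) hD _).trans ?_
  have h3 := (euclNorm_add_le _ _).trans (add_le_add h1 h2)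
  linarith

/-- With D = W X⁻¹ the right-hand side is h = (AW) D v, so its energy is the squared norm of a
projection of D v. Here `k` bounds D itself. -/
theorem energy_delayed_le (hA : A.rank = m) (hx : ∀ j, 0 < x j) (hw : ∀ j, 0 < w j) {k : ℝ}
    (hk0 : 0 ≤ k) (hkw : ∀ j, |w j / x j| ≤ k) {h : Fin m → ℝ}
    (hh : h = A *ᵥ fun j => w j * w j * (c j / μ - 1 / x j)) :
    h ⬝ᵥ (normalMatrix A w)⁻¹ *ᵥ h ≤ (k * euclNorm (barrierResidual c x μ)) ^ 2 := by
  have hMw := normalMatrix_posDef hA hw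
  rw [normalMatrix_eq_mul_transpose] at hMw ⊢
  have hu : (fun j => w j * w j * (c j / μ - 1 / x j)) =
      w * ((fun j => w j / x j) * barrierResidual c x μ) := by
    ext j
    have h1 := (hx j).ne'
    simp only [Pi.mul_apply, barrierResidual_apply]
    field_simp
  rw [hh, hu, ← mul_diagonal_mulVec]
  refine (quadForm_inv_mulVec_le hMw _).trans ?_
  exact pow_le_pow_left₀ (euclNorm_nonneg _) (euclNorm_mul_le hk0 hkw _) 2

end Accuracy

/-! ### The algorithm -/

-- The 8n operations are n comparisons, n squarings, 4n for u and 2n for the returned vector.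
open Counted in
theorem delayedDirection_eq_of_pcgLoop_eq {m n : ℕ} {A : Matrix (Fin m) (Fin n) ℝ}
    {c : Fin n → ℝ} {μ ν ε : ℝ} {x z w : Fin n → ℝ} {L : Matrix (Fin m) (Fin m) ℝ} {k T : ℕ}
    {d : Fin m → ℝ} (hw : w = (delayedPoint ν x z).val)
    (hloop : pcgLoop A (w * w) L ε k
      (pcgInit L (A *ᵥ fun j => w j * w j * (c j / μ - 1 / x j))).val = ⟨some d, T⟩) :
    delayedDirection A c μ ν ε x z L k =
      ⟨some fun j => w j * w j * (Aᵀ *ᵥ d) j - w j * w j * (c j / μ - 1 / x j),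
        8 * n + 4 * m * n + 4 * m ^ 2 + 6 * m + T⟩ := by
  have hq : (fun j => w j * w j) = w * w := rfl
  have key : ∀ t : Counted (Option (Fin n → ℝ)), ∀ a b, t.val = a → t.ops = b → t = ⟨a, b⟩ := by
    rintro ⟨_, _⟩ _ _ rfl rfl
    rfl
  apply key <;>
    simp only [delayedDirection, val_bind, ops_bind, ← hw, val_vec, val_mul, val_mulVec, val_sub,
      val_div, hq, hloop, ops_vec, ops_mul, ops_div, ops_sub, ops_mulVec,
      ops_pcgInit, val_pure, ops_pure]
  simp [delayedPoint]
  ring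

/-- Enough steps for reducing the energy by the factor `8 / 9` at a time. -/
theorem energy_reduction_le {V ε : ℝ} (hV : 0 ≤ V) (hε : 0 < ε) {K : ℕ}
    (hK : 81 * Real.log (2 + V / ε) ≤ K) :
    25 * (9 / 4) * ((1 - 1 / (4 * (9 / 4))) ^ K * (5 / 4 * V) ^ 2) ≤ ε ^ 2 := by
  have hV0 : 0 ≤ V / ε := div_nonneg hV hε.le
  -- As 1 - 1/9 ≤ exp(-1/9), the 81 = 9 · 9 in the step count yields the ninth power.
  have h1 : (1 - 1 / (4 * (9 / 4)) : ℝ) ^ K ≤ ((2 + V / ε) ^ 9)⁻¹ := by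
    calc (1 - 1 / (4 * (9 / 4)) : ℝ) ^ K ≤ Real.exp (-(1 / 9)) ^ K := by
          apply pow_le_pow_left₀ (by norm_num)
          have := Real.add_one_le_exp (-(1 / 9) : ℝ)
          linarith
      _ = Real.exp (-(K / 9)) := by
          rw [← Real.exp_nat_mul]
          congr 1
          ring
      _ ≤ Real.exp (-(9 * Real.log (2 + V / ε))) := by
          apply Real.exp_le_exp.2
          linarith
      _ = ((2 + V / ε) ^ 9)⁻¹ := by
          rw [Real.exp_neg, show (9 : ℝ) = (9 : ℕ) by norm_num, Real.exp_nat_mul,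
            Real.exp_log (by linarith)]
  -- Two of the nine factors absorb (V/ε)²; the other seven give 2⁷ = 128, above the constant 87.9.
  have h2 : 25 * (9 / 4) * (5 / 4) ^ 2 * (V / ε) ^ 2 ≤ (2 + V / ε) ^ 9 := by
    have h3 : (2 : ℝ) ^ 7 ≤ (2 + V / ε) ^ 7 := pow_le_pow_left₀ (by norm_num) (by linarith) 7
    have h4 : (V / ε) ^ 2 ≤ (2 + V / ε) ^ 2 := pow_le_pow_left₀ hV0 (by linarith) 2
    calc 25 * (9 / 4) * (5 / 4) ^ 2 * (V / ε) ^ 2 ≤ 2 ^ 7 * (V / ε) ^ 2 := by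
          nlinarith [sq_nonneg (V / ε)]
      _ ≤ (2 + V / ε) ^ 7 * (2 + V / ε) ^ 2 := mul_le_mul h3 h4 (sq_nonneg _) (by positivity)
      _ = (2 + V / ε) ^ 9 := by ring
  have hpos : 0 < (2 + V / ε) ^ 9 := by positivity
  calc 25 * (9 / 4) * ((1 - 1 / (4 * (9 / 4))) ^ K * (5 / 4 * V) ^ 2)
      ≤ 25 * (9 / 4) * (((2 + V / ε) ^ 9)⁻¹ * (5 / 4 * V) ^ 2) := by gcongr
    _ = (25 * (9 / 4) * (5 / 4) ^ 2 * (V / ε) ^ 2) / (2 + V / ε) ^ 9 * ε ^ 2 := by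
        field_simp
    _ ≤ 1 * ε ^ 2 := by
        gcongr
        exact div_le_one_of_le₀ h2 hpos.le
    _ = ε ^ 2 := one_mul _

/-- The left side is at most the sum of the two logarithms on the right. Both are at least log 2 >
2/3, and s + t ≤ 3st whenever s, t ≥ 2/3. -/
theorem log_two_add_div_le {V ε : ℝ} (hV : 0 ≤ V) (hε : 0 < ε) (hε2 : ε ≤ 1 / 2) :
    Real.log (2 + V / ε) ≤ 3 * (Real.log (2 + V) * Real.log (1 / ε)) := by
  have hinv : 2 ≤ 1 / ε := by rw [le_div_iff₀ hε]; linarith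
  have h1 : Real.log (2 + V / ε) ≤ Real.log (2 + V) + Real.log (1 / ε) := by
    rw [← Real.log_mul (by positivity) (by positivity)]
    apply Real.log_le_log (by positivity)
    calc 2 + V / ε = 2 + V * (1 / ε) := by ring
      _ ≤ (2 + V) * (1 / ε) := by linarith
  have h2 : Real.log 2 ≤ Real.log (2 + V) := Real.log_le_log (by norm_num) (by linarith)
  have h3 : Real.log 2 ≤ Real.log (1 / ε) := Real.log_le_log (by norm_num) hinv
  have h4 := Real.log_two_gt_d9
  nlinarith

theorem exists_delayedDirection_eq {m n : ℕ} {A : Matrix (Fin m) (Fin n) ℝ} {c x z : Fin n → ℝ}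
    {L : Matrix (Fin m) (Fin m) ℝ} {μ ν ε lamz : ℝ} (hA : A.rank = m) (hε : 0 < ε)
    (hlam : 0 ≤ lamz) (hx : ∀ j, 0 < x j) (hz : ∀ j, 0 < z j)
    (hpsd : (normalMatrix A z - lamz • (1 : Matrix (Fin m) (Fin m) ℝ)).PosSemidef)
    (hL : IsTriangularFactor L (normalMatrix A z))
    (hdist : thresholdedDist x ν z x * (2 * ‖A‖) ≤ Real.sqrt lamz)
    (hquarter : thresholdedDist x ν z x ≤ 1 / 4)
    (hprox : thresholdedDist x ν z x * (6 * proximity A c x μ) ≤ ε) {K : ℕ}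
    (hK : 81 * Real.log (2 + euclNorm (barrierResidual c x μ) / ε) ≤ K) :
    ∃ (dx : Fin n → ℝ) (T : ℕ),
      (∀ maxIter : ℕ, K ≤ maxIter → delayedDirection A c μ ν ε x z L maxIter = ⟨some dx, T⟩) ∧
      scaledNorm x (newtonDirection A c x μ - dx) ≤ ε ∧
      T ≤ 8 * n + 4 * m * n + 4 * m ^ 2 + 6 * m +
        (3 + K * (4 * m * n + n + 4 * m ^ 2 + 14 * m + 6)) := by
  set w := (delayedPoint ν x z).val with hw
  set k := thresholdedDist x ν z x
  have hk0 : 0 ≤ k := thresholdedDist_nonneg _ _ _ _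
  have hwpos : ∀ j, 0 < w j := delayedPoint_pos hx hz
  have hwx : ∀ j, |w j / x j - 1| ≤ k := abs_delayedPoint_div_sub_one_le hx
  have hMw := normalMatrix_posDef hA hwpos
  have hMz := normalMatrix_posDef hA hz
  have hbounds := quadForm_normalMatrix_bounds (w := w) hk0 hlam abs_delayedPoint_sub_le hpsd hdist
  set h := A *ᵥ fun j => w j * w j * (c j / μ - 1 / x j) with hh
  have hE : h ⬝ᵥ (normalMatrix A w)⁻¹ *ᵥ h ≤
      (5 / 4 * euclNorm (barrierResidual c x μ)) ^ 2 := by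
    refine energy_delayed_le hA hx hwpos (by norm_num) (fun j => ?_) hh
    have := abs_le.1 (hwx j)
    rw [abs_le]
    constructor <;> linarith
  have hstart : 25 * (9 / 4) * ((1 - 1 / (4 * (9 / 4))) ^ K *
      (h ⬝ᵥ (normalMatrix A w)⁻¹ *ᵥ h)) ≤ ε ^ 2 := by
    refine le_trans ?_ (energy_reduction_le (euclNorm_nonneg _) hε hK)
    gcongr
  have hinit := isPCGIterate_pcgInit (M := normalMatrix A w) hMz hL h
  have hlow := fun y => (hbounds y).1
  have hupp := fun y => (hbounds y).2
  rw [normalMatrix_eq_diagonal_mul_self A w] at hMw hstart hinit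
  simp only [normalMatrix_eq_diagonal_mul_self A w] at hlow hupp
  obtain ⟨d, T, hloop, hT, hres⟩ := hinit.exists_pcgLoop_eq hMw hMz hL (by norm_num : (0 : ℝ) < 4)
    (by norm_num : (0 : ℝ) < 9 / 4) (by norm_num) hlow hupp K _ hstart
  refine ⟨_, _, fun maxIter hmax => delayedDirection_eq_of_pcgLoop_eq hw (hloop maxIter hmax), ?_,
    Nat.add_le_add_left hT _⟩
  refine scaledNorm_newtonDirection_sub_le hA hx hwpos hk0 hquarter hε hwx hprox rfl ?_
  rw [normalMatrix_eq_diagonal_mul_self A w, ← hh]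
  -- Passing from the computable M_Z⁻¹ norm of the residual to the M_W⁻¹ norm costs the factor 4.
  have := inv_quadForm_le_of_quadForm_le hMz hMw (by norm_num : (0 : ℝ) < 4) hlow
    (h - (A * Matrix.diagonal (w * w) * Aᵀ) *ᵥ d)
  linarith

end PrimalIPM

open PrimalIPM
theorem mainTheorem5 :
    ∃ C : ℝ, 0 < C ∧
      ∀ (m n : ℕ) (A : Matrix (Fin m) (Fin n) ℝ) (b : Fin m → ℝ) (c x z : Fin n → ℝ)
        (L : Matrix (Fin m) (Fin m) ℝ) (μ ν ε lamz : ℝ),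
        0 < n → A.rank = m →
        0 < μ → 0 < ν → ν ≤ 1 → 0 < ε → 0 ≤ lamz →
        x ∈ strictlyFeasible A b → z ∈ strictlyFeasible A b →
        (normalMatrix A z - lamz • (1 : Matrix (Fin m) (Fin m) ℝ)).PosSemidef →
        IsTriangularFactor L (normalMatrix A z) →
        -- `‖z - x‖_{x,ν} ≤ min {√lamz / (2 ‖A‖), 1/4, ε / (6 δ(x, μ))}`, where `a / 0 = ∞`
        thresholdedDist x ν z x * (2 * ‖A‖) ≤ Real.sqrt lamz →
        thresholdedDist x ν z x ≤ 1 / 4 →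
        thresholdedDist x ν z x * (6 * proximity A c x μ) ≤ ε →
        ∃ (dx : Fin n → ℝ) (T N : ℕ),
          (∀ maxIter : ℕ, N ≤ maxIter →
            delayedDirection A c μ ν ε x z L maxIter = ⟨some dx, T⟩) ∧
          scaledNorm x (newtonDirection A c x μ - dx) ≤ ε ∧
          (T : ℝ) ≤ C * (n : ℝ) ^ 2 *
            Real.log (2 + euclNorm (barrierResidual c x μ) / ε) ∧
          (ε ≤ 1 / 2 →
            (T : ℝ) ≤ C * Real.log (2 + euclNorm (barrierResidual c x μ)) *
              (n : ℝ) ^ 2 * Real.log (1 / ε)) := by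
  -- 2500 suffices for the first bound; the product form of the logarithms costs the further factor
  -- 3.
  refine ⟨7500, by norm_num, ?_⟩
  intro m n A b c x z L μ ν ε lamz hn hA _ _ _ hε hlam hx hz hpsd hL hdist hquarter hprox
  set V := euclNorm (barrierResidual c x μ)
  have hV : 0 ≤ V := euclNorm_nonneg _
  set l := Real.log (2 + V / ε) with hl
  -- Lets l absorb the setup cost and the rounding up of the step count: 25 + 29(81 l + 1) ≤ 2500 l.
  have hl2 : 1 / 2 ≤ l := by
    have h1 : Real.log 2 ≤ l :=
      Real.log_le_log (by norm_num) (by linarith [div_nonneg hV hε.le])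
    linarith [Real.log_two_gt_d9]
  obtain ⟨dx, T, hrun, hacc, hT⟩ := exists_delayedDirection_eq hA hε hlam hx.2 hz.2 hpsd hL hdist
    hquarter hprox (Nat.le_ceil (81 * l))
  have hmn : m ≤ n := hA ▸ A.rank_le_width
  -- With m ≤ n and n ≥ 1 each monomial is at most n²: 8 + 4 + 4 + 6 + 3 = 25 for the setup and the
  -- last test, 4 + 1 + 4 + 14 + 6 = 29 per step.
  have hT' : T ≤ n ^ 2 * (25 + 29 * ⌈81 * l⌉₊) := by
    refine hT.trans ?_
    have hn1 : 1 ≤ n ^ 2 := Nat.one_le_pow _ _ hn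
    have hnn : n ≤ n ^ 2 := Nat.le_self_pow two_ne_zero n
    have hmn' : m * n ≤ n ^ 2 := by rw [sq]; exact Nat.mul_le_mul_right n hmn
    have hm2 : m ^ 2 ≤ n ^ 2 := Nat.pow_le_pow_left hmn 2
    have hstep : ⌈81 * l⌉₊ * (4 * m * n + n + 4 * m ^ 2 + 14 * m + 6) ≤
        ⌈81 * l⌉₊ * (29 * n ^ 2) := Nat.mul_le_mul_left _ (by rw [mul_assoc]; omega)
    rw [mul_assoc]
    linarith
  have hTl : (T : ℝ) ≤ 2500 * (n : ℝ) ^ 2 * l := by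
    have hceil := (Nat.ceil_lt_add_one (by linarith : 0 ≤ 81 * l)).le
    calc (T : ℝ) ≤ (n : ℝ) ^ 2 * (25 + 29 * (⌈81 * l⌉₊ : ℝ)) := by exact_mod_cast hT'
      _ ≤ (n : ℝ) ^ 2 * (2500 * l) := by
        gcongr
        linarith
      _ = 2500 * (n : ℝ) ^ 2 * l := by ring
  refine ⟨dx, T, _, hrun, hacc, hTl.trans ?_, fun hε2 => hTl.trans ?_⟩
  · gcongr
    norm_num
  · calc 2500 * (n : ℝ) ^ 2 * l
        ≤ 2500 * (n : ℝ) ^ 2 * (3 * (Real.log (2 + V) * Real.log (1 / ε))) := by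
          gcongr
          exact log_two_add_div_le hV hε hε2
      _ = 7500 * Real.log (2 + V) * (n : ℝ) ^ 2 * Real.log (1 / ε) := by ring
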